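/- Let $\mu$ be a compactly supported Borel probability measure on $\mathbb{R}^d$, and suppose that $\mu$ is spectral with a full-rank lattice $\Gamma\subset\mathbb{R}^d$ as spectrum, i.e. the exponentials $x\mapsto e^{2\pi i\langle\gamma,x\rangle}$, $\gamma\in\Gamma$, form an orthonormal basis of $L^2(\mu)$. Then there is a Borel set $T\subset\mathbb{R}^d$ with $0<\mathrm{Leb}(T)<\infty$, whose closure is the closed support of $\mu$, such that $\mu$ is the normalized Lebesgue measure on $T$, i.e. $\mu(E)=\mathrm{Leb}(E\cap T)/\mathrm{Leb}(T)$ for all Borel sets $E$, and such that $T$ tiles $\mathbb{R}^d$ by the dual lattice $\tilde\Gamma=\{x\in\mathbb{R}^d : \langle x,\gamma\rangle\in\mathbb{Z}\text{ for all }\gamma\in\Gamma\}$, i.e. the translates $T+t$, $t\in\tilde\Gamma$, form a partition of $\mathbb{R}^d$ up to Lebesgue measure zero. -/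

import Mathlib

open MeasureTheory

noncomputable section

namespace SpectralLattice

/-- The exponential function `e_ξ(x) = exp(2πi⟨ξ, x⟩)` on `ℝ^d`. -/
def expFun {d : ℕ} (ξ x : EuclideanSpace ℝ (Fin d)) : ℂ :=
  Complex.exp (2 * (Real.pi : ℂ) * Complex.I * ((inner ℝ ξ x : ℝ) : ℂ))

theorem memLp_expFun {d : ℕ} (μ : Measure (EuclideanSpace ℝ (Fin d))) [IsFiniteMeasure μ]
    (ξ : EuclideanSpace ℝ (Fin d)) : MemLp (expFun ξ) 2 μ := by
  refine MemLp.of_bound (C := 1) ?_ (Filter.Eventually.of_forall fun x => ?_)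
  · apply Continuous.aestronglyMeasurable
    unfold expFun
    fun_prop
  · have h : 2 * (Real.pi : ℂ) * Complex.I * ((inner ℝ ξ x : ℝ) : ℂ)
        = ((2 * Real.pi * inner ℝ ξ x : ℝ) : ℂ) * Complex.I := by
      push_cast
      ring
    rw [expFun, h, Complex.norm_exp_ofReal_mul_I]

/-- The class of `e_ξ` in `L²(μ)`. -/
def expLp {d : ℕ} (μ : Measure (EuclideanSpace ℝ (Fin d))) [IsFiniteMeasure μ]
    (ξ : EuclideanSpace ℝ (Fin d)) : Lp ℂ 2 μ :=
  (memLp_expFun μ ξ).toLp (expFun ξ)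

/-- `Λ` is a spectrum of `μ`: it is countable, and the family `(e_ξ)_{ξ ∈ Λ}` is an orthonormal
basis of `L²(μ)`, that is, it is orthonormal and its closed linear span is all of `L²(μ)`. -/
def IsSpectrum {d : ℕ} (μ : Measure (EuclideanSpace ℝ (Fin d))) [IsFiniteMeasure μ]
    (Λ : Set (EuclideanSpace ℝ (Fin d))) : Prop :=
  Λ.Countable ∧
    Orthonormal ℂ (fun ξ : Λ => expLp μ (ξ : EuclideanSpace ℝ (Fin d))) ∧
    (Submodule.span ℂ (Set.range fun ξ : Λ =>
      expLp μ (ξ : EuclideanSpace ℝ (Fin d)))).topologicalClosure = ⊤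

/-- The dual lattice `{x | ⟨x, γ⟩ ∈ ℤ for all γ ∈ Γ}`. -/
def dualLattice {d : ℕ} (Γ : Submodule ℤ (EuclideanSpace ℝ (Fin d))) :
    Submodule ℤ (EuclideanSpace ℝ (Fin d)) :=
  LinearMap.BilinForm.dualSubmodule (innerₗ (EuclideanSpace ℝ (Fin d))) Γ

theorem mem_dualLattice {d : ℕ} (Γ : Submodule ℤ (EuclideanSpace ℝ (Fin d)))
    (x : EuclideanSpace ℝ (Fin d)) :
    x ∈ dualLattice Γ ↔ ∀ γ ∈ Γ, ∃ n : ℤ, (inner ℝ x γ : ℝ) = n := by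
  simp only [dualLattice, LinearMap.BilinForm.mem_dualSubmodule, Submodule.mem_one,
    innerₗ_apply_apply]
  simp only [eq_comm, algebraMap_int_eq, eq_intCast]

/-- The Lebesgue measurable set `T` tiles `ℝ^d` by `𝒯`: the translates `T + t`, `t ∈ 𝒯`, form a
partition of `ℝ^d` up to Lebesgue measure zero. -/
def TilesBy {d : ℕ} (T 𝒯 : Set (EuclideanSpace ℝ (Fin d))) : Prop :=
  NullMeasurableSet T volume ∧
    (∀ s ∈ 𝒯, ∀ t ∈ 𝒯, s ≠ t →
      volume (((fun x => x + s) '' T) ∩ ((fun x => x + t) '' T)) = 0) ∧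
    volume (⋃ t ∈ 𝒯, (fun x => x + t) '' T)ᶜ = 0

end SpectralLattice

end

open MeasureTheory Module

open scoped ENNReal Pointwise

noncomputable section

namespace SpectralLattice

/-! The two halves of being an orthonormal basis do different jobs. Orthogonality of `e_γ` to `e_0 =
1` kills every nonzero Fourier coefficient of `μ` along `Γ`, so modulo the dual lattice `μ` becomes
uniform (`map_fract_eq_of_isSpectrum`). Completeness makes `μ` see each orbit at most once: the
`e_γ` are periodic, and functions a.e. equal to a periodic measurable one form a closed subspace,
hence all of `L²(μ)`. By compact support this subspace contains the coordinate functions; on the set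
`T` where they agree with periodic versions, a point is determined by its orbit
(`exists_measurableSet_injOn_fract`). A measure with uniform image, carried by such a `T`, is
uniform on `T`, and `T` is a fundamental domain (`isAddFundamentalDomain_of_injOn_fract`). -/

/-- Finite measures on a torus are determined by their Fourier coefficients. -/
theorem ext_of_integral_mFourier {ι : Type*} [Fintype ι] {P Q : Measure (UnitAddTorus ι)}
    [IsFiniteMeasure P] [IsFiniteMeasure Q]
    (h : ∀ n : ι → ℤ, ∫ t, UnitAddTorus.mFourier n t ∂P = ∫ t, UnitAddTorus.mFourier n t ∂Q) :
    P = Q := by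
  have key : ∀ f : C(UnitAddTorus ι, ℂ), ∫ t, f t ∂P = ∫ t, f t ∂Q := by
    have hint : ∀ (M : Measure (UnitAddTorus ι)) [IsFiniteMeasure M] (f : C(UnitAddTorus ι, ℂ)),
        Integrable f M := fun M _ f =>
      f.continuous.integrable_of_hasCompactSupport (HasCompactSupport.of_compactSpace _)
    have hcont : ∀ (M : Measure (UnitAddTorus ι)) [IsFiniteMeasure M],
        Continuous (fun f : C(UnitAddTorus ι, ℂ) => ∫ t, f t ∂M) := by
      intro M _
      refine (continuous_integral.comp (ContinuousMap.toLp (E := ℂ) 1 M ℂ).continuous).congr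
        fun f => ?_
      exact integral_congr_ae (ContinuousMap.coeFn_toLp M f)
    intro f
    have hf : f ∈ (Submodule.span ℂ
        (Set.range (UnitAddTorus.mFourier (d := ι)))).topologicalClosure := by
      rw [UnitAddTorus.span_mFourier_closure_eq_top]; trivial
    have hclosed : IsClosed {f : C(UnitAddTorus ι, ℂ) | ∫ t, f t ∂P = ∫ t, f t ∂Q} :=
      isClosed_eq (hcont P) (hcont Q)
    refine closure_minimal (fun g hg => ?_) hclosed hf
    refine Submodule.span_induction (p := fun g _ => ∫ t, g t ∂P = ∫ t, g t ∂Q) ?_ ?_ ?_ ?_ hg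
    · rintro _ ⟨n, rfl⟩
      exact h n
    · simp
    · intro x y _ _ hx hy
      simp only [ContinuousMap.add_apply]
      rw [integral_add (hint P x) (hint P y), integral_add (hint Q x) (hint Q y), hx, hy]
    · intro a x _ hx
      simp only [ContinuousMap.smul_apply]
      rw [integral_smul, integral_smul, hx]
  refine ext_of_forall_integral_eq_of_IsFiniteMeasure fun f => ?_
  have := key ⟨fun t => (f t : ℂ), by fun_prop⟩
  simp only [ContinuousMap.coe_mk, integral_complex_ofReal] at this
  exact_mod_cast this

/-! ### Reduction modulo the lattice spanned by a basis. -/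

section Basis

variable {E ι : Type*} [NormedAddCommGroup E] [NormedSpace ℝ E] [Fintype ι] (b : Basis ι ℝ E)

/-- The coordinates of a vector in the basis `b`, modulo one. -/
def torusMap (x : E) : UnitAddTorus ι := fun i => (b.repr x i : UnitAddCircle)

/-- The section of `torusMap b` with values in the fundamental domain of `b`. -/
def torusSection (t : UnitAddTorus ι) : E :=
  ∑ i, ((AddCircle.equivIco 1 0 (t i) : ℝ)) • b i

theorem torusSection_torusMap (x : E) : torusSection b (torusMap b x) = ZSpan.fract b x := by
  refine b.ext_elem fun i => ?_
  have h : ∀ r : ℝ, ((AddCircle.equivIco (1 : ℝ) 0 (r : UnitAddCircle) : ℝ)) = Int.fract r :=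
    fun r => (AddCircle.coe_equivIco_mk_apply (1 : ℝ) r).trans (by simp)
  simp only [torusSection, torusMap, b.repr_sum_self, ZSpan.repr_fract_apply, h]

theorem continuous_torusMap : Continuous (torusMap b) := by
  have := b.finiteDimensional_of_finite
  refine continuous_pi fun i => (AddCircle.continuous_mk' 1).comp ?_
  exact (b.coord i).continuous_of_finiteDimensional

variable [MeasurableSpace E]

/-- The σ-algebra of the measurable sets that are periodic with respect to the lattice spanned
by `b`. -/
abbrev periodicMeasurableSpace : MeasurableSpace E :=
  MeasurableSpace.comap (ZSpan.fract b) inferInstance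

variable [BorelSpace E]

theorem measurable_torusSection : Measurable (torusSection b) := by
  have := b.finiteDimensional_of_finite
  have := FiniteDimensional.proper ℝ E
  refine Finset.measurable_sum _ fun i _ => Measurable.smul_const ?_ _
  exact measurable_subtype_coe.comp
    ((AddCircle.measurableEquivIco 1 0).measurable.comp (measurable_pi_apply i))

theorem measurable_zspanFract : Measurable (ZSpan.fract b) := by
  rw [← funext (torusSection_torusMap b)]
  exact (measurable_torusSection b).comp (continuous_torusMap b).measurable

/-- Two finite measures with the same integrals of all periodic characters have the same image
in the fundamental domain. -/
theorem map_fract_eq_of_integral_mFourier {P Q : Measure E} [IsFiniteMeasure P] [IsFiniteMeasure Q]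
    (h : ∀ n : ι → ℤ, ∫ x, UnitAddTorus.mFourier n (torusMap b x) ∂P =
      ∫ x, UnitAddTorus.mFourier n (torusMap b x) ∂Q) :
    P.map (ZSpan.fract b) = Q.map (ZSpan.fract b) := by
  have hm := (continuous_torusMap b).measurable
  have h1 : P.map (torusMap b) = Q.map (torusMap b) := by
    refine ext_of_integral_mFourier fun n => ?_
    have hc := (UnitAddTorus.mFourier n).continuous
    rw [integral_map hm.aemeasurable hc.aestronglyMeasurable,
      integral_map hm.aemeasurable hc.aestronglyMeasurable, h n]
  rw [← funext (torusSection_torusMap b)]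
  have h2 := congrArg (Measure.map (torusSection b)) h1
  rwa [Measure.map_map (measurable_torusSection b) hm,
    Measure.map_map (measurable_torusSection b) hm] at h2

theorem periodicMeasurableSpace_le : periodicMeasurableSpace b ≤ ‹MeasurableSpace E› :=
  (measurable_zspanFract b).comap_le

/-- The saturation of `F` is a countable union of lattice translates of `F`. -/
theorem measurableSet_fract_preimage_image {F : Set E} (hF : MeasurableSet F) :
    MeasurableSet (ZSpan.fract b ⁻¹' (ZSpan.fract b '' F)) := by
  have : ZSpan.fract b ⁻¹' (ZSpan.fract b '' F) =
      ⋃ v : Submodule.span ℤ (Set.range b), (fun x => x + (v : E)) ⁻¹' F := by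
    ext x
    simp only [Set.mem_preimage, Set.mem_image, Set.mem_iUnion]
    constructor
    · rintro ⟨y, hy, hxy⟩
      refine ⟨⟨-x + y, (ZSpan.fract_eq_fract b x y).1 hxy.symm⟩, ?_⟩
      simpa using hy
    · rintro ⟨v, hv⟩
      exact ⟨_, hv, ZSpan.fract_add_ZSpan b x v.2⟩
  rw [this]
  exact MeasurableSet.iUnion fun v => (measurable_add_const _) hF

variable {b} in
/-- A probability measure whose image in the fundamental domain is uniform, and which is carried by
a set `T` meeting each orbit at most once, is uniform on `T`, and `T` is a fundamental domain. -/
theorem isAddFundamentalDomain_of_injOn_fract (vol : Measure E) [vol.IsAddHaarMeasure]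
    {μ : Measure E} [IsProbabilityMeasure μ] {c : ℝ≥0∞}
    (hμ : μ.map (ZSpan.fract b) = c • vol.restrict (ZSpan.fundamentalDomain b))
    {T : Set E} (hT : MeasurableSet T) (hμT : μ Tᶜ = 0) (hinj : Set.InjOn (ZSpan.fract b) T) :
    IsAddFundamentalDomain (Submodule.span ℤ (Set.range b)) T vol ∧
      μ = c • vol.restrict T := by
  have := b.finiteDimensional_of_finite
  have := FiniteDimensional.proper ℝ E
  have : VAddInvariantMeasure (Submodule.span ℤ (Set.range b)) E vol :=
    inferInstanceAs (VAddInvariantMeasure (Submodule.span ℤ (Set.range b)).toAddSubgroup E vol)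
  set D := ZSpan.fundamentalDomain b with hD
  have hDm : MeasurableSet D := ZSpan.fundamentalDomain_measurableSet b
  have hDf := ZSpan.isAddFundamentalDomain b vol
  have hc0 : c ≠ 0 := by
    rintro rfl
    have h1 := congrArg (fun m : Measure E => m Set.univ) hμ
    simp [Measure.map_apply (measurable_zspanFract b) MeasurableSet.univ] at h1
  have hsat : ∀ F, MeasurableSet F →
      μ (ZSpan.fract b ⁻¹' (ZSpan.fract b '' F)) =
        c * vol ((ZSpan.fract b ⁻¹' (ZSpan.fract b '' F)) ∩ D) := by
    intro F hF
    have hA := measurableSet_fract_preimage_image b hF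
    have h1 := congrArg (fun m : Measure E => m (ZSpan.fract b ⁻¹' (ZSpan.fract b '' F))) hμ
    simp only [Measure.map_apply (measurable_zspanFract b) hA, Measure.smul_apply, smul_eq_mul,
      Measure.restrict_apply hA] at h1
    rw [← h1]
    congr 1
    ext x
    simp [ZSpan.fract_fract]
  have hinv : ∀ F (g : Submodule.span ℤ (Set.range b)),
      (fun x => g +ᵥ x) ⁻¹' (ZSpan.fract b ⁻¹' (ZSpan.fract b '' F)) =
        ZSpan.fract b ⁻¹' (ZSpan.fract b '' F) := by
    intro F g
    ext x
    simp only [Set.mem_preimage, Submodule.vadd_def, vadd_eq_add, ZSpan.fract_zSpan_add b x g.2]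
  have hfd : IsAddFundamentalDomain (Submodule.span ℤ (Set.range b)) T vol := by
    refine ⟨hT.nullMeasurableSet, ?_, ?_⟩
    · have hA := measurableSet_fract_preimage_image b hT
      set A := ZSpan.fract b ⁻¹' (ZSpan.fract b '' T) with hAdef
      -- The periodic set `A` is `μ`-conull, so uniformity of the image makes `Aᶜ` null in `D`, and
      -- periodicity makes it null everywhere.
      have hA0 : μ Aᶜ = 0 :=
        measure_mono_null (Set.compl_subset_compl.2 (Set.subset_preimage_image _ _)) hμT
      have hAD : vol (Aᶜ ∩ D) = 0 := by
        have h1 := congrArg (fun m : Measure E => m Aᶜ) hμ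
        simp only [Measure.map_apply (measurable_zspanFract b) hA.compl, Measure.smul_apply,
          smul_eq_mul, Measure.restrict_apply hA.compl] at h1
        have h2 : ZSpan.fract b ⁻¹' Aᶜ = Aᶜ := by
          ext x
          simp [hAdef, ZSpan.fract_fract]
        rw [h2, hA0] at h1
        exact (mul_eq_zero.1 h1.symm).resolve_left hc0
      have hAc : vol Aᶜ = 0 := by
        refine hDf.measure_zero_of_invariant _ (fun g => ?_) hAD
        rw [← Set.preimage_vadd_neg, Set.preimage_compl, hinv T (-g)]
      filter_upwards [compl_mem_ae_iff.2 hAc] with x hx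
      rw [compl_compl] at hx
      obtain ⟨y, hy, hxy⟩ := hx
      refine ⟨⟨-x + y, (ZSpan.fract_eq_fract b x y).1 hxy.symm⟩, ?_⟩
      simpa [Submodule.vadd_def] using hy
    · intro g h hgh
      refine Disjoint.aedisjoint (Set.disjoint_left.2 ?_)
      rintro _ ⟨x, hx, rfl⟩ ⟨y, hy, hxy⟩
      simp only [Submodule.vadd_def, vadd_eq_add] at hxy
      have h1 : ZSpan.fract b y = ZSpan.fract b x := by
        rw [← ZSpan.fract_zSpan_add b y h.2, hxy, ZSpan.fract_zSpan_add b x g.2]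
      have h2 := hinj hy hx h1
      subst h2
      exact hgh (Subtype.ext (add_right_cancel hxy).symm)
  refine ⟨hfd, Measure.ext fun F hF => ?_⟩
  -- By injectivity the saturation of `F ∩ T` adds no points inside `T`. Being periodic, it has the
  -- same volume in `D` as in `T`.
  have hFT := hF.inter hT
  have hA := measurableSet_fract_preimage_image b hFT
  have h3 : ZSpan.fract b ⁻¹' (ZSpan.fract b '' (F ∩ T)) ∩ T = F ∩ T := by
    ext x
    constructor
    · rintro ⟨⟨y, hy, hxy⟩, hx⟩
      rwa [← hinj hy.2 hx hxy]
    · exact fun hx => ⟨⟨x, hx, rfl⟩, hx.2⟩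
  have hres : ∀ S, μ (S ∩ T) = μ S := fun S =>
    measure_inter_conull hμT
  rw [Measure.smul_apply, Measure.restrict_apply hF, smul_eq_mul, ← hres F]
  conv_lhs => rw [← h3]
  rw [hres, hsat _ hFT, hDf.measure_set_eq hfd hA (hinv _), h3]

end Basis

/-! ### Consequences of having a lattice spectrum. -/

section Spectral

variable {d : ℕ}

theorem expFun_eq_exp_ofReal_mul_I (ξ x : EuclideanSpace ℝ (Fin d)) :
    expFun ξ x = Complex.exp (((2 * Real.pi * inner ℝ ξ x : ℝ) : ℂ) * Complex.I) := by
  rw [expFun]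
  congr 1
  push_cast
  ring

theorem continuous_expFun (ξ : EuclideanSpace ℝ (Fin d)) : Continuous (expFun ξ) := by
  unfold expFun
  fun_prop

theorem expFun_add (ξ x y : EuclideanSpace ℝ (Fin d)) :
    expFun ξ (x + y) = expFun ξ x * expFun ξ y := by
  rw [expFun, expFun, expFun, ← Complex.exp_add, inner_add_right]
  congr 1
  push_cast
  ring

theorem expFun_eq_one_of_mem_dualLattice {Γ : Submodule ℤ (EuclideanSpace ℝ (Fin d))}
    {γ v : EuclideanSpace ℝ (Fin d)} (hγ : γ ∈ Γ) (hv : v ∈ dualLattice Γ) : expFun γ v = 1 := by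
  obtain ⟨n, hn⟩ := (mem_dualLattice Γ v).1 hv γ hγ
  rw [expFun, real_inner_comm, hn, Complex.exp_eq_one_iff]
  exact ⟨n, by push_cast; ring⟩

/-- The dual lattice is spanned by a basis of the space, in whose coordinates the characters with
frequencies in the lattice are the Fourier monomials. -/
theorem exists_basis_dualLattice (Γ : Submodule ℤ (EuclideanSpace ℝ (Fin d))) [DiscreteTopology Γ]
    [IsZLattice ℝ Γ] :
    ∃ (ι : Type) (_ : Fintype ι) (b : Basis ι ℝ (EuclideanSpace ℝ (Fin d))),
      Submodule.span ℤ (Set.range b) = dualLattice Γ ∧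
      ∀ n : ι → ℤ, ∃ γ ∈ Γ, ∀ x, UnitAddTorus.mFourier n (torusMap b x) = expFun γ x := by
  classical
  let β := (Module.Free.chooseBasis ℤ Γ)
  let B := β.ofZLatticeBasis ℝ
  have hB : LinearMap.BilinForm.Nondegenerate (innerₗ (EuclideanSpace ℝ (Fin d))) := by
    refine ⟨fun x hx => ?_, fun x hx => ?_⟩ <;> simpa using hx x
  have hspan : Submodule.span ℤ (Set.range B) = Γ := β.ofZLatticeBasis_span ℝ
  -- Coordinates in the dual basis are inner products with the `B i`, so the monomial `n` has
  -- frequency `∑ i, n i • B i`.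
  refine ⟨_, inferInstance, LinearMap.BilinForm.dualBasis _ hB B, ?_, fun n => ?_⟩
  · rw [← LinearMap.BilinForm.dualSubmodule_span_of_basis, hspan]
    rfl
  · refine ⟨∑ i, n i • B i, ?_, fun x => ?_⟩
    · exact Submodule.sum_mem _ fun i _ => Submodule.smul_mem _ _
        (hspan.le (Submodule.subset_span ⟨i, rfl⟩))
    · simp only [UnitAddTorus.mFourier, ContinuousMap.coe_mk, torusMap, fourier_coe_apply,
        LinearMap.BilinForm.dualBasis_repr_apply, expFun, sum_inner, innerₗ_apply_apply]
      rw [← Complex.exp_sum]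
      congr 1
      push_cast
      rw [Finset.mul_sum]
      refine Finset.sum_congr rfl fun i _ => ?_
      rw [← Int.cast_smul_eq_zsmul ℝ, real_inner_smul_left, real_inner_comm]
      push_cast
      ring

theorem integral_expFun_eq_zero_of_orthonormal {μ : Measure (EuclideanSpace ℝ (Fin d))}
    [IsFiniteMeasure μ] {Λ : Set (EuclideanSpace ℝ (Fin d))}
    (h : Orthonormal ℂ fun ξ : Λ => expLp μ (ξ : EuclideanSpace ℝ (Fin d)))
    (h0 : 0 ∈ Λ) {ξ : EuclideanSpace ℝ (Fin d)} (hξ : ξ ∈ Λ) (hne : ξ ≠ 0) :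
    ∫ x, expFun ξ x ∂μ = 0 := by
  have h1 : inner ℂ (expLp μ 0) (expLp μ ξ) = 0 :=
    h.2 (i := ⟨0, h0⟩) (j := ⟨ξ, hξ⟩) fun h => hne (congrArg Subtype.val h).symm
  rw [L2.inner_def] at h1
  rw [← h1]
  refine integral_congr_ae ?_
  filter_upwards [(memLp_expFun μ 0).coeFn_toLp, (memLp_expFun μ ξ).coeFn_toLp] with x hx0 hx
  rw [expLp, expLp, hx0, hx]
  simp [expFun]

theorem setIntegral_fundamentalDomain_expFun_eq_zero {Γ : Submodule ℤ (EuclideanSpace ℝ (Fin d))}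
    {ι : Type*} [Fintype ι] {b : Basis ι ℝ (EuclideanSpace ℝ (Fin d))}
    (hb : Submodule.span ℤ (Set.range b) = dualLattice Γ)
    {γ : EuclideanSpace ℝ (Fin d)} (hγ : γ ∈ Γ) (hne : γ ≠ 0) :
    ∫ x in ZSpan.fundamentalDomain b, expFun γ x = 0 := by
  have : VAddInvariantMeasure (Submodule.span ℤ (Set.range b)) (EuclideanSpace ℝ (Fin d)) volume :=
    inferInstanceAs (VAddInvariantMeasure (Submodule.span ℤ (Set.range b)).toAddSubgroup
      (EuclideanSpace ℝ (Fin d)) volume)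
  have hD := ZSpan.isAddFundamentalDomain b (volume : Measure (EuclideanSpace ℝ (Fin d)))
  -- Chosen so that `⟨γ, v⟩ = 1/2`: translating the domain by `v` keeps the integral by periodicity,
  -- yet flips its sign.
  set v : EuclideanSpace ℝ (Fin d) := (2 * inner ℝ γ γ : ℝ)⁻¹ • γ with hv
  have hγv : expFun γ v = -1 := by
    have h0 : (inner ℝ γ γ : ℝ) ≠ 0 := fun h => hne (inner_self_eq_zero.1 h)
    have h1 : (2 * Real.pi * inner ℝ γ v : ℝ) = Real.pi := by
      rw [hv, real_inner_smul_right]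
      field_simp
    rw [expFun_eq_exp_ofReal_mul_I, h1, Complex.exp_pi_mul_I]
  have h1 : ∫ x in ZSpan.fundamentalDomain b, expFun γ x =
      ∫ x in v +ᵥ ZSpan.fundamentalDomain b, expFun γ x := by
    refine hD.setIntegral_eq (hD.vadd_of_comm v) fun g x => ?_
    rw [Submodule.vadd_def, vadd_eq_add, expFun_add,
      expFun_eq_one_of_mem_dualLattice hγ (hb ▸ g.2), one_mul]
  have h2 : ∫ x in v +ᵥ ZSpan.fundamentalDomain b, expFun γ x =
      ∫ x in ZSpan.fundamentalDomain b, expFun γ (v +ᵥ x) :=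
    (measurePreserving_vadd v volume).setIntegral_image_emb (measurableEmbedding_const_vadd v) _ _
  simp only [vadd_eq_add, expFun_add, hγv, integral_const_mul] at h2
  rw [← h1] at h2
  linear_combination h2 / 2

/-- The image of a measure with spectrum `Γ` in a fundamental domain of the dual lattice is the
normalized Lebesgue measure. -/
theorem map_fract_eq_of_isSpectrum {μ : Measure (EuclideanSpace ℝ (Fin d))} [IsProbabilityMeasure μ]
    {Γ : Submodule ℤ (EuclideanSpace ℝ (Fin d))}
    (hΓ : IsSpectrum μ (Γ : Set (EuclideanSpace ℝ (Fin d))))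
    {ι : Type*} [Fintype ι] {b : Basis ι ℝ (EuclideanSpace ℝ (Fin d))}
    (hb : Submodule.span ℤ (Set.range b) = dualLattice Γ)
    (hbΓ : ∀ n : ι → ℤ, ∃ γ ∈ Γ, ∀ x, UnitAddTorus.mFourier n (torusMap b x) = expFun γ x) :
    μ.map (ZSpan.fract b) = (volume (ZSpan.fundamentalDomain b))⁻¹ •
      volume.restrict (ZSpan.fundamentalDomain b) := by
  set D := ZSpan.fundamentalDomain b with hDdef
  have hD0 : volume D ≠ 0 := ZSpan.measure_fundamentalDomain_ne_zero b
  have hDt : volume D ≠ ∞ := (ZSpan.fundamentalDomain_isBounded b).measure_lt_top.ne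
  have hDm : MeasurableSet D := ZSpan.fundamentalDomain_measurableSet b
  set ν : Measure (EuclideanSpace ℝ (Fin d)) := (volume D)⁻¹ • volume.restrict D with hν
  have : IsProbabilityMeasure ν :=
    ⟨by simp [hν, ENNReal.inv_mul_cancel hD0 hDt]⟩
  have h1 : ν.map (ZSpan.fract b) = ν := by
    rw [hν, Measure.map_smul]
    congr 1
    conv_rhs => rw [← Measure.map_id (μ := volume.restrict D)]
    refine Measure.map_congr ?_
    filter_upwards [ae_restrict_mem hDm] with x hx
    exact (ZSpan.fract_eq_self (b := b)).2 hx
  rw [← h1]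
  refine map_fract_eq_of_integral_mFourier b fun n => ?_
  obtain ⟨γ, hγ, hn⟩ := hbΓ n
  simp only [hn]
  rcases eq_or_ne γ 0 with rfl | hne
  · simp [expFun]
  · rw [integral_expFun_eq_zero_of_orthonormal hΓ.2.1 Γ.zero_mem hγ hne, hν, integral_smul_measure,
      setIntegral_fundamentalDomain_expFun_eq_zero hb hγ hne, smul_zero]

/-- If the measure has the spectrum `Γ`, every square integrable function is almost everywhere
periodic with respect to the dual lattice. -/
theorem aestronglyMeasurable_comap_fract_of_isSpectrum {μ : Measure (EuclideanSpace ℝ (Fin d))}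
    [IsFiniteMeasure μ] {Γ : Submodule ℤ (EuclideanSpace ℝ (Fin d))}
    (hΓ : IsSpectrum μ (Γ : Set (EuclideanSpace ℝ (Fin d))))
    {ι : Type*} [Fintype ι] {b : Basis ι ℝ (EuclideanSpace ℝ (Fin d))}
    (hb : Submodule.span ℤ (Set.range b) = dualLattice Γ)
    {f : EuclideanSpace ℝ (Fin d) → ℂ} (hf : MemLp f 2 μ) :
    AEStronglyMeasurable[periodicMeasurableSpace b] f μ := by
  have hexp : ∀ γ ∈ Γ, expLp μ γ ∈ lpMeas ℂ ℂ (periodicMeasurableSpace b) 2 μ := by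
    intro γ hγ
    refine mem_lpMeas_iff_aestronglyMeasurable.2 ⟨expFun γ, ?_, (memLp_expFun μ γ).coeFn_toLp⟩
    have h1 : expFun γ = expFun γ ∘ ZSpan.fract b := by
      ext x
      have h2 : expFun γ (ZSpan.floor b x : EuclideanSpace ℝ (Fin d)) = 1 :=
        expFun_eq_one_of_mem_dualLattice hγ (hb ▸ (ZSpan.floor b x).2)
      have h3 := expFun_add γ (ZSpan.fract b x) (ZSpan.floor b x)
      rw [h2, mul_one, ZSpan.fract_apply, sub_add_cancel] at h3
      exact h3
    rw [h1]
    exact ((continuous_expFun γ).measurable.comp (comap_measurable _)).stronglyMeasurable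
  have hall : hf.toLp f ∈ lpMeas ℂ ℂ (periodicMeasurableSpace b) 2 μ := by
    have hmem : hf.toLp f ∈ (Submodule.span ℂ
        (Set.range fun ξ : (Γ : Set (EuclideanSpace ℝ (Fin d))) =>
          expLp μ (ξ : EuclideanSpace ℝ (Fin d)))).topologicalClosure := by
      rw [hΓ.2.2]; trivial
    have hclosed : IsClosed
        ((lpMeas ℂ ℂ (periodicMeasurableSpace b) 2 μ : Submodule ℂ (Lp ℂ 2 μ)) :
          Set (Lp ℂ 2 μ)) :=
      isClosed_aestronglyMeasurable (periodicMeasurableSpace_le b)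
    refine Submodule.topologicalClosure_minimal _ (Submodule.span_le.2 ?_) hclosed hmem
    rintro _ ⟨γ, rfl⟩
    exact hexp γ γ.2
  exact (mem_lpMeas_iff_aestronglyMeasurable.1 hall).congr hf.coeFn_toLp

/-- A compactly supported measure with the spectrum `Γ` is carried by a subset of its support that
meets each orbit of the dual lattice at most once. -/
theorem exists_measurableSet_injOn_fract {μ : Measure (EuclideanSpace ℝ (Fin d))}
    [IsFiniteMeasure μ] (hμ : IsCompact μ.support) {Γ : Submodule ℤ (EuclideanSpace ℝ (Fin d))}
    (hΓ : IsSpectrum μ (Γ : Set (EuclideanSpace ℝ (Fin d))))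
    {ι : Type*} [Fintype ι] {b : Basis ι ℝ (EuclideanSpace ℝ (Fin d))}
    (hb : Submodule.span ℤ (Set.range b) = dualLattice Γ) :
    ∃ T ⊆ μ.support, MeasurableSet T ∧ μ Tᶜ = 0 ∧ Set.InjOn (ZSpan.fract b) T := by
  have hcoord : ∀ i : Fin d, AEStronglyMeasurable[periodicMeasurableSpace b]
      (fun x : EuclideanSpace ℝ (Fin d) => (x i : ℂ)) μ := by
    intro i
    refine aestronglyMeasurable_comap_fract_of_isSpectrum hΓ hb ?_
    obtain ⟨C, hC⟩ := hμ.isBounded.exists_norm_le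
    refine MemLp.of_bound (C := C) ?_ ?_
    · apply Continuous.aestronglyMeasurable
      fun_prop
    · filter_upwards [Measure.support_mem_ae (μ := μ)] with x hx
      rw [Complex.norm_real]
      exact (PiLp.norm_apply_le x i).trans (hC x hx)
  choose g hg hgx using hcoord
  refine ⟨μ.support ∩ ⋂ i, {x | (x i : ℂ) = g i x}, Set.inter_subset_left, ?_, ?_, ?_⟩
  · refine Measure.isClosed_support.measurableSet.inter (MeasurableSet.iInter fun i => ?_)
    refine measurableSet_eq_fun ?_ ((hg i).mono (periodicMeasurableSpace_le b)).measurable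
    apply Continuous.measurable
    fun_prop
  · rw [← mem_ae_iff]
    refine Filter.inter_mem Measure.support_mem_ae ?_
    rw [← Filter.eventually_mem_set]
    filter_upwards [ae_all_iff.2 hgx] with x hx
    exact Set.mem_iInter.2 hx
  · rintro x ⟨-, hx⟩ y ⟨-, hy⟩ hxy
    ext i
    have h1 : (x i : ℂ) = g i x := Set.mem_iInter.1 hx i
    have h2 : (y i : ℂ) = g i y := Set.mem_iInter.1 hy i
    -- Measurability for the σ-algebra pulled back by `ZSpan.fract b` forces `g i` to factor through
    -- it.
    have h3 : g i x = g i y := (hg i).factorsThrough hxy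
    exact_mod_cast h1.trans (h3.trans h2.symm)

theorem tilesBy_of_isAddFundamentalDomain {L : Submodule ℤ (EuclideanSpace ℝ (Fin d))}
    {T : Set (EuclideanSpace ℝ (Fin d))} (hT : IsAddFundamentalDomain L T volume) :
    TilesBy T (L : Set (EuclideanSpace ℝ (Fin d))) := by
  have himg : ∀ v : L, (fun x => x + (v : EuclideanSpace ℝ (Fin d))) '' T = v +ᵥ T := by
    intro v
    refine Set.image_congr fun x _ => ?_
    exact add_comm x _
  refine ⟨hT.nullMeasurableSet, fun s hs t ht hst => ?_, ?_⟩
  · have h := hT.aedisjoint (i := ⟨s, hs⟩) (j := ⟨t, ht⟩) fun h => hst (congrArg Subtype.val h)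
    have hs' := himg ⟨s, hs⟩
    have ht' := himg ⟨t, ht⟩
    simp only at hs' ht'
    rw [hs', ht']
    exact h
  · rw [← mem_ae_iff]
    filter_upwards [hT.ae_covers] with x hx
    obtain ⟨g, hg⟩ := hx
    refine Set.mem_biUnion (L.neg_mem g.2) ⟨_, hg, ?_⟩
    simp [Submodule.vadd_def]

end Spectral

end SpectralLattice

end

theorem mainTheorem7 {d : ℕ} (μ : Measure (EuclideanSpace ℝ (Fin d))) [IsProbabilityMeasure μ]
    (hμ : IsCompact μ.support)
    (Γ : Submodule ℤ (EuclideanSpace ℝ (Fin d))) [DiscreteTopology Γ] [IsZLattice ℝ Γ]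
    (hΓ : SpectralLattice.IsSpectrum μ (Γ : Set (EuclideanSpace ℝ (Fin d)))) :
    ∃ T : Set (EuclideanSpace ℝ (Fin d)),
      MeasurableSet T ∧ closure T = μ.support ∧
      0 < volume T ∧ volume T < ⊤ ∧
      μ = (volume T)⁻¹ • volume.restrict T ∧
      SpectralLattice.TilesBy T
        (SpectralLattice.dualLattice Γ : Set (EuclideanSpace ℝ (Fin d))) := by
  obtain ⟨ι, _, b, hb, hbΓ⟩ := SpectralLattice.exists_basis_dualLattice Γ
  obtain ⟨T, hTs, hTm, hT0, hinj⟩ := SpectralLattice.exists_measurableSet_injOn_fract hμ hΓ hb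
  obtain ⟨hfd, hμT⟩ := SpectralLattice.isAddFundamentalDomain_of_injOn_fract volume
    (SpectralLattice.map_fract_eq_of_isSpectrum hΓ hb hbΓ) hTm hT0 hinj
  have : VAddInvariantMeasure (Submodule.span ℤ (Set.range b)) (EuclideanSpace ℝ (Fin d)) volume :=
    inferInstanceAs (VAddInvariantMeasure (Submodule.span ℤ (Set.range b)).toAddSubgroup
      (EuclideanSpace ℝ (Fin d)) volume)
  -- Fundamental domains of one lattice have equal volume, which turns the constant into `(volume
  -- T)⁻¹`.
  rw [(ZSpan.isAddFundamentalDomain b volume).measure_eq hfd] at hμT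
  refine ⟨T, hTm, ?_, ?_, ?_, hμT, ?_⟩
  · refine (closure_minimal hTs Measure.isClosed_support).antisymm ?_
    refine Measure.support_subset_of_isClosed isClosed_closure ?_
    exact Filter.mem_of_superset (mem_ae_iff.2 hT0) subset_closure
  · exact pos_iff_ne_zero.2 (hfd.measure_ne_zero (NeZero.ne volume))
  · exact (measure_mono hTs).trans_lt hμ.measure_lt_top
  · rw [← hb]
    exact SpectralLattice.tilesBy_of_isAddFundamentalDomain hfd
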